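/- Let $G$ be a finite group and $k$ a commutative Noetherian ring. Let $\mathcal C=\mathrm{FI}_G$ be the category with objects $[n]=\{1,\dots,n\}$, $n\ge 0$, whose morphisms $[n]\to[m]$ are the pairs $(f,g)$ of an injection $f:[n]\hookrightarrow[m]$ and a map of sets $g:[n]\to G$, with composition $(f,g)\circ(f',g')=(f\circ f',h)$, $h(x)=g'(x)\,g(f'(x))$. Write $G_n=\mathrm{End}_{\mathcal C}([n])\cong G\wr\mathfrak S_n$. A $\mathcal C$-module is a functor from $\mathcal C$ to $k$-modules. Let $\iota:\mathcal C\to\mathcal C$ be the functor $[n]\mapsto[n+1]$, $(f,g)\mapsto(f_+,g_+)$, where $f_+:[n+1]\to[m+1]$ extends $f:[n]\to[m]$ by $f_+(n+1)=m+1$ and $g_+$ extends $g$ by $g_+(n+1)=1$; on endomorphisms it gives the inclusion $G_n\subset G_{n+1}$. The shift functor is $\Sigma V=V\circ\iota$. For a $kG_n$-module $W$, the basic filtered module $M(W)$ is the $\mathcal C$-module $M(W)_m=k[\mathrm{Hom}_{\mathcal C}([n],[m])]\otimes_{kG_n}W$, with induced maps given by composition on the first factor; put $M(n)=M(kG_n)=k[\mathrm{Hom}_{\mathcal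 C}([n],-)]$. The coinduction functor $R$ on $\mathcal C$-modules is $R(V)_n=\mathrm{Hom}_{\mathcal C\text{-Mod}}(\Sigma M(n),V)$, where a morphism $h:[n]\to[m]$ sends $\phi\in R(V)_n$ to the element $h_*\phi\in R(V)_m$ with $(h_*\phi)_r(p)=\phi_r(p\circ h)$ for all $r$ and all morphisms $p:[m]\to[r+1]$. **Theorem.** Let $n\ge 0$ and let $W$ be a finitely generated $kG_n$-module. Then $R(M(W))$ is a direct sum of basic filtered modules; more specifically, there is an isomorphism of $\mathcal C$-modules $$R(M(W))\;\cong\; M(W)\oplus M\bigl(\mathrm{Ind}_{G_n}^{G_{n+1}}W\bigr),$$ where $\mathrm{Ind}_{G_n}^{G_{n+1}}W=kG_{n+1}\otimes_{kG_n}W$. -/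

import Mathlib

open CategoryTheory CategoryTheory.Limits
open scoped TensorProduct

universe u v

/-- The objects `[n]`, `n ≥ 0`, of the category `FI_G`; here `[n]` is modelled by `Fin n`. -/
structure FIG (G : Type v) : Type where
  n : ℕ

section BalancedTensor

variable {k X Y W P S : Type*} [CommRing k] [Monoid S]
  [AddCommGroup X] [Module k X] [AddCommGroup Y] [Module k Y]
  [AddCommGroup W] [Module k W] [AddCommGroup P] [Module k P]

/-- Let the monoid `S` act on `X` from the right by `k`-linear maps `r s : x ↦ x s`, and on `W` from
the left by `l s : w ↦ s w`. The `k`-module `X ⊗_{kS} W` is the quotient of `X ⊗_k W` by the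
submodule spanned by all `x s ⊗ w - x ⊗ s w`. -/
abbrev BalancedTensor (r : S → X →ₗ[k] X) (l : Representation k S W) : Type _ :=
  (X ⊗[k] W) ⧸ Submodule.span k
    {t : X ⊗[k] W | ∃ (s : S) (x : X) (w : W), t = r s x ⊗ₜ[k] w - x ⊗ₜ[k] l s w}

namespace BalancedTensor

/-- The pure tensor `x ⊗ w` in `X ⊗_{kS} W`. -/
def tmul (r : S → X →ₗ[k] X) (l : Representation k S W) (x : X) (w : W) : BalancedTensor r l :=
  Submodule.Quotient.mk (x ⊗ₜ[k] w)

lemma hom_ext {r : S → X →ₗ[k] X} {l : Representation k S W} {f g : BalancedTensor r l →ₗ[k] P}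
    (h : ∀ x w, f (tmul r l x w) = g (tmul r l x w)) : f = g :=
  Submodule.linearMap_qext _ (TensorProduct.ext' h)

/-- The map `X ⊗_{kS} W → Y ⊗_{kS} W`, `x ⊗ w ↦ f x ⊗ w`, induced by a `k`-linear map `f : X → Y`
which commutes with the right actions of `S`. -/
def mapLeft {r : S → X →ₗ[k] X} {r' : S → Y →ₗ[k] Y} (l : Representation k S W) (f : X →ₗ[k] Y)
    (hf : ∀ s x, f (r s x) = r' s (f x)) : BalancedTensor r l →ₗ[k] BalancedTensor r' l :=
  Submodule.mapQ _ _ (f.rTensor W) <| Submodule.span_le.mpr <| by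
    rintro _ ⟨s, x, w, rfl⟩
    exact Submodule.subset_span ⟨s, f x, w, by simp [hf]⟩

@[simp]
lemma mapLeft_tmul {r : S → X →ₗ[k] X} {r' : S → Y →ₗ[k] Y} (l : Representation k S W)
    (f : X →ₗ[k] Y) (hf : ∀ s x, f (r s x) = r' s (f x)) (x : X) (w : W) :
    mapLeft l f hf (tmul r l x w) = tmul r' l (f x) w := rfl

end BalancedTensor

end BalancedTensor

namespace FIG

/-- A morphism `(f, g) : [n] → [m]` of `FI_G`: an injection `f : [n] ↪ [m]` together with a map of
sets `g : [n] → G`. -/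
@[ext]
structure Hom {G : Type v} (a b : FIG G) : Type v where
  f : Fin a.n ↪ Fin b.n
  g : Fin a.n → G

variable {G : Type v} [Group G]

/-- Composition: `(f, g) ∘ (f', g') = (f ∘ f', h)` with `h x = g' x * g (f' x)`.
In Lean's diagrammatic order this is `(f', g') ≫ (f, g)`. -/
instance category : Category.{v} (FIG G) where
  Hom := Hom
  id a := ⟨Function.Embedding.refl _, fun _ => 1⟩
  comp p q := ⟨p.f.trans q.f, fun x => p.g x * q.g (p.f x)⟩
  id_comp p := Hom.ext (by ext; rfl) (by funext x; exact one_mul _)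
  comp_id p := Hom.ext (by ext; rfl) (by funext x; exact mul_one _)
  assoc p q r := Hom.ext (by ext; rfl) (by funext x; exact mul_assoc _ _ _)

/-- The self-embedding `ι : FI_G ⥤ FI_G`, `[n] ↦ [n+1]`, `(f, g) ↦ (f₊, g₊)`, where `f₊` extends `f`
by sending the last element to the last element and `g₊` extends `g` by the value `1`. -/
def shiftEmb : FIG G ⥤ FIG G where
  obj a := ⟨a.n + 1⟩
  map {a b} p :=
    { f := ⟨fun x => Fin.lastCases (motive := fun _ => Fin (b.n + 1)) (Fin.last b.n)
          (fun i => (p.f i).castSucc) x, by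
        intro x y
        induction x using Fin.lastCases <;> induction y using Fin.lastCases <;>
          simp [Fin.castSucc_ne_last, (Fin.castSucc_ne_last _).symm]⟩
      g := fun x => Fin.lastCases (motive := fun _ => G) 1 (fun i => p.g i) x }
  map_id a := by
    refine Hom.ext ?_ ?_
    · ext x
      change ((Fin.lastCases _ _ x : Fin (a.n + 1)) : ℕ) = x
      induction x using Fin.lastCases <;> simp <;> rfl
    · funext x
      change (Fin.lastCases _ _ x : G) = 1
      induction x using Fin.lastCases <;> simp <;> rfl
  map_comp {a b c} p q := by
    refine Hom.ext ?_ ?_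
    · ext x
      change ((Fin.lastCases _ _ x : Fin (c.n + 1)) : ℕ) =
        (Fin.lastCases _ _ (Fin.lastCases _ _ x : Fin (b.n + 1)) : Fin (c.n + 1))
      induction x using Fin.lastCases <;> simp <;> rfl
    · funext x
      change (Fin.lastCases _ _ x : G) = (Fin.lastCases _ _ x : G) *
        (Fin.lastCases _ _ (Fin.lastCases _ _ x : Fin (b.n + 1)) : G)
      induction x using Fin.lastCases <;> simp <;> rfl

end FIG

/-- `G_n = End_{FI_G}([n])`, the wreath product of `G` with the symmetric group on `n` letters.
Multiplication is composition of morphisms, `x * y = x ∘ y`. -/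
abbrev WrGroup (G : Type v) [Group G] (n : ℕ) : Type v := End (FIG.mk n : FIG G)

namespace WrGroup

variable {G : Type v} [Group G] {n : ℕ}

/-- The underlying permutation of an element of `G_n`. -/
noncomputable def perm (x : WrGroup G n) : Equiv.Perm (Fin n) :=
  Equiv.ofBijective x.f (Finite.injective_iff_bijective.mp x.f.injective)

/-- The endomorphism monoid `G_n` is a group. -/
noncomputable instance group : Group (WrGroup G n) where
  inv x := FIG.Hom.mk x.perm.symm.toEmbedding fun j => (x.g (x.perm.symm j))⁻¹
  inv_mul_cancel x := by
    refine FIG.Hom.ext ?_ ?_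
    · ext i
      exact congrArg Fin.val (x.perm.symm_apply_apply i)
    · funext i
      change x.g i * (x.g (x.perm.symm (x.perm i)))⁻¹ = 1
      rw [Equiv.symm_apply_apply, mul_inv_cancel]

/-- The inclusion `G_n → G_{n+1}`, `(f, g) ↦ (f₊, g₊)`. -/
def incl (G : Type v) [Group G] (n : ℕ) : WrGroup G n →* WrGroup G (n + 1) :=
  FIG.shiftEmb.mapEnd (FIG.mk n)

end WrGroup

namespace FIG

variable (k : Type u) [CommRing k] (G : Type v) [Group G]

/-- The category of `FI_G`-modules over `k`: functors from `FI_G` to `k`-modules. -/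
abbrev Mod := FIG G ⥤ ModuleCat.{max u v} k

/-- The shift functor `Σ V = V ∘ ι`. -/
def shift : Mod k G ⥤ Mod k G := (Functor.whiskeringLeft _ _ _).obj shiftEmb

/-- The free `FI_G`-modules `M(n) = k[Hom([n], -)]` (which is `k[Hom([n], -)] ⊗_{kG_n} kG_n`),
contravariantly functorial in `[n]` by precomposition of morphisms. -/
noncomputable def free : (FIG G)ᵒᵖ ⥤ Mod k G where
  obj a :=
    { obj := fun b => ModuleCat.of k ((a.unop ⟶ b) →₀ k)
      map := fun q => ModuleCat.ofHom (Finsupp.lmapDomain k k fun p => p ≫ q)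
      map_id := fun b => by
        ext p : 3
        simp [LinearMap.ext_iff]
      map_comp := fun q r => by
        ext p : 3
        simp }
  map {a a'} h :=
    { app := fun b => ModuleCat.ofHom (Finsupp.lmapDomain k k fun p => h.unop ≫ p)
      naturality := fun b c q => by
        ext p : 3
        simp }
  map_id a := by
    ext b p : 4
    simp [LinearMap.ext_iff]
  map_comp h h' := by
    ext b p : 4
    simp [LinearMap.ext_iff]

/-- The coinduction functor: `R(V)_n = Hom(Σ M(n), V)`, the `k`-module of morphisms of
`FI_G`-modules. A morphism `h : [n] → [m]` sends `φ` to the map `p ↦ φ (p ∘ h)`,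
i.e. it acts by precomposition with `Σ` of the map `M(m) → M(n)` induced by `h`. -/
noncomputable def coind : Mod k G ⥤ Mod k G where
  obj V :=
    { obj := fun a => ModuleCat.of k ((shift k G).obj ((free k G).obj (.op a)) ⟶ V)
      map := fun h => ModuleCat.ofHom
        (Linear.leftComp k V ((shift k G).map ((free k G).map h.op)))
      map_id := fun a => by
        ext φ : 2
        simp
      map_comp := fun h h' => by
        ext φ : 2
        simp }
  map {V V'} η :=
    { app := fun a => ModuleCat.ofHom (Linear.rightComp k _ η)
      naturality := fun a b h => by
        ext φ : 2
        simp }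
  map_id V := by
    ext a φ : 4
    simp
  map_comp η η' := by
    ext a φ : 4
    simp

variable {k G} {n : ℕ}

/-- The right action of `G_n` on `k[Hom([n], [m])]` by precomposition, `p ↦ p ∘ s`. -/
noncomputable def rightAct (n : ℕ) (b : FIG G) (s : WrGroup G n) :
    ((free k G).obj (.op (FIG.mk n))).obj b →ₗ[k] ((free k G).obj (.op (FIG.mk n))).obj b :=
  (((free k G).map s.asHom.op).app b).hom

/-- The basic filtered module `M(W)` of a `kG_n`-module `W`:
`M(W)_m = k[Hom([n], [m])] ⊗_{kG_n} W`, with induced maps given by composition on the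
first factor. -/
noncomputable def basicFiltered (W : Rep.{max u v} k (WrGroup G n)) : Mod k G where
  obj b := ModuleCat.of k (BalancedTensor (rightAct (k := k) n b) W.ρ)
  map {b c} q := ModuleCat.ofHom
    (BalancedTensor.mapLeft W.ρ (((free k G).obj (.op (FIG.mk n))).map q).hom fun s x =>
      (congrArg (fun F => F.hom x) (((free k G).map s.asHom.op).naturality q)).symm)
  map_id b := by
    ext : 1
    refine BalancedTensor.hom_ext fun x w => ?_
    simp
  map_comp q r := by
    ext : 1
    refine BalancedTensor.hom_ext fun x w => ?_
    simp
    rfl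

end FIG

/-!
Write `ι : [m] ↦ [m+1]` for the self-embedding whose restriction functor is the shift `Σ`. An
element `φ` of `R(V)_m = Hom(Σ M(m), V)` is a family of values `φ(p)`, one for each morphism
`p : [m] → [r+1]`, compatible with composition with morphisms `ι h`. If the image of `p` avoids the
last element, then `p` is a morphism `[m] → [r]` followed by the standard inclusion, so `φ(p)` is
determined by the value of `φ` at `incl : [m] → [m+1]`. Otherwise `m = b + 1` and `p = ι q ∘ τ` for
one of the finitely many automorphisms `τ = toLast b i` of `[m]`, where `i` records the element sent
to the last one and its label. Hence `φ` is determined by its values at `incl` and at the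
`toLast b i` (`coind_ext_toLast`).

Transposition along the adjunction `Σ ⊣ R` (`coindLift`) turns two morphisms into maps to `R(M(W))`:
* `avoidLast : Σ M(W) ⟶ M(W)` keeps the pure tensors `p ⊗ w` for which the image of `p` avoids the
  last element and kills the others. It retracts the map `M(W) ⟶ Σ M(W)` given by `incl`, so the
  transpose `M(W) ⟶ R(M(W))` is a section of the evaluation at `incl`.
* `fixLast : Σ M(Ind W) ⟶ M(W)` keeps the pure tensors `p ⊗ (1 ⊗ w)` for which `p = ι q` and kills
  the others. Its transpose identifies `M(Ind W)` with the kernel of the evaluation at `incl`: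
  for each `q : [n+1] → [b+1]` exactly one of the composites of `q` with the `toLast b i` has the
  form `ι q'`. Therefore the maps `fixLastAt` at the `toLast b i` are the coordinates of a direct
  sum decomposition of `M(Ind W)_{b+1}` into copies of `M(W)_b`, indexed by `i`, whose inclusions are
  the maps `extendAt` (`fixLastAt_extendAt_self`, `fixLastAt_extendAt_of_ne`,
  `sum_extendAt_fixLastAt`). Finiteness of `G` makes the number of copies finite.

So the two transposes together are an isomorphism from `M(W) ⊞ M(Ind W)` to `R(M(W))`.
-/

/-! ### Balanced tensor products -/

namespace BalancedTensor

variable {k X W P S : Type*} [CommRing k] [Monoid S] [AddCommGroup X] [Module k X]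
  [AddCommGroup W] [Module k W] [AddCommGroup P] [Module k P]

/-- The map `X ⊗_{kS} W → P`, `x ⊗ w ↦ f x w`, induced by an `S`-balanced bilinear map `f`. -/
def lift {r : S → X →ₗ[k] X} {l : Representation k S W} (f : X →ₗ[k] W →ₗ[k] P)
    (hf : ∀ s x w, f (r s x) w = f x (l s w)) : BalancedTensor r l →ₗ[k] P :=
  Submodule.liftQ _ (TensorProduct.lift f) <| Submodule.span_le.mpr <| by
    rintro _ ⟨s, x, w, rfl⟩
    simp [hf]

lemma tmul_balanced (r : S → X →ₗ[k] X) (l : Representation k S W) (s : S) (x : X) (w : W) :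
    tmul r l (r s x) w = tmul r l x (l s w) :=
  (Submodule.Quotient.eq _).mpr (Submodule.subset_span ⟨s, x, w, rfl⟩)

end BalancedTensor

/-! ### Morphisms into `[m + 1]` -/

namespace FIG

variable {G : Type v} [Group G] {a b c : FIG G}

/-- The last element of `ι [n] = [n+1]`. -/
def last (a : FIG G) : Fin (shiftEmb.obj a).n := Fin.last a.n

/-- The standard inclusion `[n] → [n+1]`, with constant label `1`. -/
def incl (a : FIG G) : a ⟶ shiftEmb.obj a := Hom.mk Fin.castSuccEmb fun _ => 1

lemma comp_f (p : a ⟶ b) (q : b ⟶ c) (x : Fin a.n) : (p ≫ q).f x = q.f (p.f x) := rfl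

lemma comp_g (p : a ⟶ b) (q : b ⟶ c) (x : Fin a.n) :
    (p ≫ q).g x = p.g x * q.g (p.f x) := rfl

lemma shiftEmb_map_f_incl (p : a ⟶ b) (x : Fin a.n) :
    (shiftEmb.map p).f ((incl a).f x) = (incl b).f (p.f x) :=
  Fin.lastCases_castSucc (motive := fun _ => Fin (b.n + 1)) ..

lemma shiftEmb_map_f_last (p : a ⟶ b) : (shiftEmb.map p).f (last a) = last b :=
  Fin.lastCases_last (motive := fun _ => Fin (b.n + 1)) ..

lemma shiftEmb_map_g_incl (p : a ⟶ b) (x : Fin a.n) :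
    (shiftEmb.map p).g ((incl a).f x) = p.g x :=
  Fin.lastCases_castSucc (motive := fun _ => G) ..

lemma shiftEmb_map_g_last (p : a ⟶ b) : (shiftEmb.map p).g (last a) = 1 :=
  Fin.lastCases_last (motive := fun _ => G) ..

lemma incl_f_ne_last (x : Fin a.n) : (incl a).f x ≠ last a := Fin.castSucc_ne_last x

lemma exists_incl_f_eq {x : Fin (shiftEmb.obj a).n} (hx : x ≠ last a) :
    ∃ y, (incl a).f y = x :=
  ⟨Fin.castPred x hx, Fin.castSucc_castPred x hx⟩

lemma hom_ext {p q : a ⟶ b} (hf : ∀ x, p.f x = q.f x) (hg : ∀ x, p.g x = q.g x) : p = q :=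
  Hom.ext (DFunLike.ext _ _ hf) (funext hg)

lemma incl_naturality (p : a ⟶ b) : incl a ≫ shiftEmb.map p = p ≫ incl b :=
  hom_ext (shiftEmb_map_f_incl p) fun x =>
    (one_mul _).trans ((shiftEmb_map_g_incl p x).trans (mul_one _).symm)

lemma comp_incl_injective (a b : FIG G) : Function.Injective fun p : a ⟶ b => p ≫ incl b := by
  intro p q h
  refine hom_ext (fun x => (incl b).f.injective ?_) fun x => ?_
  · exact congrArg (fun t : a ⟶ shiftEmb.obj b => t.f x) h
  · exact mul_right_cancel (congrArg (fun t : a ⟶ shiftEmb.obj b => t.g x) h)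

lemma shiftEmb_map_injective (a b : FIG G) :
    Function.Injective fun p : a ⟶ b => shiftEmb.map p := by
  intro p q h
  apply comp_incl_injective
  change p ≫ incl b = q ≫ incl b
  rw [← incl_naturality, ← incl_naturality]
  exact congrArg (incl a ≫ ·) h

lemma mem_range_comp_incl {p : a ⟶ shiftEmb.obj b} :
    p ∈ Set.range (fun q : a ⟶ b => q ≫ incl b) ↔ ∀ x, p.f x ≠ last b := by
  constructor
  · rintro ⟨q, rfl⟩ x
    exact incl_f_ne_last _
  · intro h
    choose f hf using fun x => exists_incl_f_eq (h x)
    refine ⟨Hom.mk ⟨f, fun x y hxy => p.f.injective ?_⟩ p.g, hom_ext hf fun x => mul_one _⟩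
    rw [← hf x, hxy, hf y]

lemma mem_range_shiftEmb_map {p : shiftEmb.obj a ⟶ shiftEmb.obj b} :
    p ∈ Set.range (fun q : a ⟶ b => shiftEmb.map q) ↔ p.f (last a) = last b ∧ p.g (last a) = 1 := by
  constructor
  · rintro ⟨q, rfl⟩
    exact ⟨shiftEmb_map_f_last q, shiftEmb_map_g_last q⟩
  · rintro ⟨hf, hg⟩
    have h : incl a ≫ p ∈ Set.range (fun q : a ⟶ b => q ≫ incl b) :=
      mem_range_comp_incl.mpr fun x hx =>
        incl_f_ne_last x (p.f.injective (hx.trans hf.symm))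
    -- The restriction of `p` to `[n]` comes from a morphism `q`, whose extension is `p`.
    obtain ⟨q, hq⟩ := h
    replace hq : incl a ≫ shiftEmb.map q = incl a ≫ p := (incl_naturality q).trans hq
    refine ⟨q, hom_ext (fun x => ?_) fun x => ?_⟩
    · obtain rfl | hx := eq_or_ne x (last a)
      · exact (shiftEmb_map_f_last q).trans hf.symm
      · obtain ⟨y, rfl⟩ := exists_incl_f_eq hx
        exact congrArg (fun t : a ⟶ shiftEmb.obj b => t.f y) hq
    · obtain rfl | hx := eq_or_ne x (last a)
      · exact (shiftEmb_map_g_last q).trans hg.symm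
      · obtain ⟨y, rfl⟩ := exists_incl_f_eq hx
        exact mul_left_cancel (congrArg (fun t : a ⟶ shiftEmb.obj b => t.g y) hq)

lemma mem_range_comp_incl_of_comp {p : a ⟶ shiftEmb.obj b} (h : b ⟶ c)
    (hp : p ≫ shiftEmb.map h ∈ Set.range fun q : a ⟶ c => q ≫ incl c) :
    p ∈ Set.range fun q : a ⟶ b => q ≫ incl b := by
  rw [mem_range_comp_incl] at hp ⊢
  intro x hx
  exact hp x (by rw [comp_f, hx, shiftEmb_map_f_last])

lemma mem_range_shiftEmb_map_of_comp {p : shiftEmb.obj a ⟶ shiftEmb.obj b} (h : b ⟶ c)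
    (hp : p ≫ shiftEmb.map h ∈ Set.range fun q : a ⟶ c => shiftEmb.map q) :
    p ∈ Set.range fun q : a ⟶ b => shiftEmb.map q := by
  rw [mem_range_shiftEmb_map] at hp ⊢
  obtain ⟨hf, hg⟩ := hp
  have h1 : p.f (last a) = last b :=
    (shiftEmb.map h).f.injective (hf.trans (shiftEmb_map_f_last h).symm)
  rw [comp_g, h1, shiftEmb_map_g_last, mul_one] at hg
  exact ⟨h1, hg⟩

/-- For a position `i.1` in `[n+1]` and a label `i.2`, an automorphism of `[n+1]` which sends `i.1`
to the last element with label `i.2`. The other labels do not matter; all of them are `i.2`. -/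
def toLast (b : FIG G) (i : Fin (shiftEmb.obj b).n × G) : shiftEmb.obj b ≅ shiftEmb.obj b where
  hom := Hom.mk (Equiv.swap i.1 (last b)).toEmbedding fun _ => i.2
  inv := Hom.mk (Equiv.swap i.1 (last b)).toEmbedding fun _ => i.2⁻¹
  hom_inv_id := hom_ext (fun x => Equiv.swap_apply_self _ _ x) fun _ => mul_inv_cancel _
  inv_hom_id := hom_ext (fun x => Equiv.swap_apply_self _ _ x) fun _ => inv_mul_cancel _

/-- Each `q : [m+1] → [n+1]` becomes the extension of a morphism `[m] → [n]` after composition with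
exactly one of the automorphisms `toLast b i`. -/
lemma comp_toLast_mem_range_iff (q : shiftEmb.obj a ⟶ shiftEmb.obj b)
    (i : Fin (shiftEmb.obj b).n × G) :
    q ≫ (toLast b i).hom ∈ Set.range (fun p : a ⟶ b => shiftEmb.map p) ↔
      i = (q.f (last a), (q.g (last a))⁻¹) := by
  have h : Equiv.swap i.1 (last b) (q.f (last a)) = last b ↔ i.1 = q.f (last a) := by
    rw [Equiv.swap_apply_eq_iff, Equiv.swap_apply_right, eq_comm]
  rw [mem_range_shiftEmb_map, Prod.ext_iff]
  exact and_congr h (mul_eq_one_iff_eq_inv'.trans (by rfl))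

lemma shiftEmb_map_comp_toLast_mem_range_iff (q : a ⟶ b) (i j : Fin (shiftEmb.obj b).n × G) :
    (shiftEmb.map q ≫ (toLast b i).inv) ≫ (toLast b j).hom ∈
      Set.range (fun p : a ⟶ b => shiftEmb.map p) ↔ j = i := by
  rw [comp_toLast_mem_range_iff, comp_f, comp_g, shiftEmb_map_f_last, shiftEmb_map_g_last, one_mul]
  have h : ((toLast b i).inv.f (last b), ((toLast b i).inv.g (last b))⁻¹) = i :=
    Prod.ext (Equiv.swap_apply_right _ _) (inv_inv _)
  rw [h]

/-- A morphism `[n+1] → [m+1]` whose image contains the last element is, up to one of the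
automorphisms `toLast b i`, the extension of a morphism `[n] → [m]`. -/
lemma exists_eq_toLast_comp {p : shiftEmb.obj b ⟶ shiftEmb.obj c}
    (hp : p ∉ Set.range fun q : shiftEmb.obj b ⟶ c => q ≫ incl c) :
    ∃ (i : Fin (shiftEmb.obj b).n × G) (q : b ⟶ c), p = (toLast b i).hom ≫ shiftEmb.map q := by
  rw [mem_range_comp_incl] at hp
  push Not at hp
  obtain ⟨x, hx⟩ := hp
  have hmem : (toLast b (x, p.g x)).inv ≫ p ∈ Set.range (fun q : b ⟶ c => shiftEmb.map q) := by
    have h : (toLast b (x, p.g x)).inv.f (last b) = x := Equiv.swap_apply_right _ _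
    rw [mem_range_shiftEmb_map, comp_f, comp_g, h]
    exact ⟨hx, inv_mul_cancel _⟩
  obtain ⟨q, hq⟩ := hmem
  exact ⟨_, q, (Iso.inv_comp_eq _).mp hq.symm⟩

end FIG

namespace FIG

variable {k : Type u} [CommRing k] {G : Type v} [Group G]

/-! ### Coinduction -/

section Coinduction

variable {V U : Mod k G} {a b r s : FIG G}

/-- The value `φ_r(p)` of `φ ∈ R(U)_n = Hom(Σ M(n), U)` at a morphism `p : [n] → [r+1]`, as a
linear function of `φ`. -/
noncomputable def coindEval (U : Mod k G) (p : a ⟶ shiftEmb.obj r) :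
    ((coind k G).obj U).obj a →ₗ[k] U.obj r where
  toFun φ := (NatTrans.app φ r).hom (Finsupp.single p 1)
  map_add' _ _ := rfl
  map_smul' _ _ := rfl

lemma coind_ext {φ ψ : ((coind k G).obj U).obj a}
    (h : ∀ (r : FIG G) (p : a ⟶ shiftEmb.obj r), coindEval U p φ = coindEval U p ψ) : φ = ψ :=
  NatTrans.ext <| funext fun r => ModuleCat.hom_ext <| Finsupp.lhom_ext' fun p =>
    LinearMap.ext_ring (h r p)

lemma coindEval_comp (p : a ⟶ shiftEmb.obj r) (h : r ⟶ s) (φ : ((coind k G).obj U).obj a) :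
    coindEval U (p ≫ shiftEmb.map h) φ = (U.map h).hom (coindEval U p φ) := by
  refine Eq.trans ?_ (congrArg (fun F => F.hom (Finsupp.single p 1)) (NatTrans.naturality φ h))
  exact congrArg (NatTrans.app φ s).hom (Finsupp.mapDomain_single (f := (· ≫ shiftEmb.map h))).symm

lemma coindEval_map (h : a ⟶ b) (p : b ⟶ shiftEmb.obj r) (φ : ((coind k G).obj U).obj a) :
    coindEval U p ((((coind k G).obj U).map h).hom φ) = coindEval U (h ≫ p) φ :=
  congrArg (NatTrans.app φ r).hom (Finsupp.mapDomain_single (f := (h ≫ ·)))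

/-- An element of `R(U)_n = Hom(Σ M(n), U)` is a family of values at the morphisms
`p : [n] → [r+1]` which is compatible with postcomposition. -/
noncomputable def coindMk (f : ∀ r : FIG G, (a ⟶ shiftEmb.obj r) → U.obj r)
    (hf : ∀ (r s : FIG G) (p : a ⟶ shiftEmb.obj r) (h : r ⟶ s),
      f s (p ≫ shiftEmb.map h) = (U.map h).hom (f r p)) : ((coind k G).obj U).obj a :=
  show (shift k G).obj ((free k G).obj (.op a)) ⟶ U from
  { app r := ModuleCat.ofHom (Finsupp.linearCombination k (f r))
    naturality r s h := ModuleCat.hom_ext <| Finsupp.lhom_ext' fun p => LinearMap.ext_ring <| by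
      refine (congrArg (Finsupp.linearCombination k (f s))
        (Finsupp.mapDomain_single (f := (· ≫ shiftEmb.map h)))).trans ?_
      refine (Finsupp.linearCombination_single k 1 _).trans ?_
      rw [one_smul, hf]
      exact congrArg (U.map h).hom
        ((Finsupp.linearCombination_single k 1 _).trans (one_smul _ _)).symm }

lemma coindEval_coindMk (f : ∀ r : FIG G, (a ⟶ shiftEmb.obj r) → U.obj r)
    (hf : ∀ (r s : FIG G) (p : a ⟶ shiftEmb.obj r) (h : r ⟶ s),
      f s (p ≫ shiftEmb.map h) = (U.map h).hom (f r p)) (p : a ⟶ shiftEmb.obj r) :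
    coindEval U p (coindMk f hf) = f r p :=
  (Finsupp.linearCombination_single k 1 p).trans (one_smul _ _)

lemma map_comp_hom_apply (V : Mod k G) (p : a ⟶ b) (q : b ⟶ r) (x : V.obj a) :
    (V.map (p ≫ q)).hom x = (V.map q).hom ((V.map p).hom x) := by
  rw [V.map_comp]
  rfl

lemma shiftHom_app_map (θ : (shift k G).obj V ⟶ U) (x : V.obj a) (r s : FIG G)
    (p : a ⟶ shiftEmb.obj r) (h : r ⟶ s) :
    (θ.app s).hom ((V.map (p ≫ shiftEmb.map h)).hom x) =
      (U.map h).hom ((θ.app r).hom ((V.map p).hom x)) := by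
  rw [map_comp_hom_apply]
  exact congrArg (fun F => F.hom ((V.map p).hom x)) (θ.naturality h)

/-- The transpose `V ⟶ R(U)` of a morphism `θ : Σ V ⟶ U` at `[n]`: it sends `x ∈ V_n` to the
morphism `Σ M(n) ⟶ U` given by `p ↦ θ (p_* x)` for `p : [n] → [r+1]`. -/
noncomputable def coindLiftApp (θ : (shift k G).obj V ⟶ U) (a : FIG G) :
    V.obj a →ₗ[k] ((coind k G).obj U).obj a where
  toFun x := coindMk (fun r p => (θ.app r).hom ((V.map p).hom x)) (shiftHom_app_map θ x)
  map_add' x y := coind_ext fun r p => by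
    refine Eq.trans ?_ ((coindEval U p).map_add _ _).symm
    rw [coindEval_coindMk, coindEval_coindMk, coindEval_coindMk, map_add]
    exact map_add (θ.app r).hom _ _
  map_smul' c x := coind_ext fun r p => by
    refine Eq.trans ?_ ((coindEval U p).map_smul _ _).symm
    rw [coindEval_coindMk, coindEval_coindMk, map_smul]
    exact map_smul (θ.app r).hom _ _

lemma coindEval_coindLiftApp (θ : (shift k G).obj V ⟶ U) (x : V.obj a)
    (p : a ⟶ shiftEmb.obj r) :
    coindEval U p (coindLiftApp θ a x) = (θ.app r).hom ((V.map p).hom x) :=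
  coindEval_coindMk (fun r p => (θ.app r).hom ((V.map p).hom x)) (shiftHom_app_map θ x) p

/-- The transpose `V ⟶ R(U)` of a morphism `θ : Σ V ⟶ U`. -/
noncomputable def coindLift (θ : (shift k G).obj V ⟶ U) : V ⟶ (coind k G).obj U where
  app a := ModuleCat.ofHom (coindLiftApp θ a)
  naturality a b h := ModuleCat.hom_ext <| LinearMap.ext fun x => coind_ext fun r p => by
    refine (coindEval_coindLiftApp θ _ p).trans ?_
    refine Eq.trans ?_ (coindEval_map h p (coindLiftApp θ a x)).symm
    rw [coindEval_coindLiftApp, map_comp_hom_apply]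
    rfl

lemma coindEval_coindLift (θ : (shift k G).obj V ⟶ U) (x : V.obj a) (p : a ⟶ shiftEmb.obj r) :
    coindEval U p (((coindLift θ).app a).hom x) = (θ.app r).hom ((V.map p).hom x) :=
  coindEval_coindLiftApp θ x p

/-- An element of `R(U)_{n+1}` is determined by its values at the standard inclusion and at the
automorphisms `toLast b i` of `[n+1]`. -/
lemma coind_ext_toLast {φ ψ : ((coind k G).obj U).obj (shiftEmb.obj b)}
    (h : coindEval U (incl _) φ = coindEval U (incl _) ψ)
    (h' : ∀ i, coindEval U (toLast b i).hom φ = coindEval U (toLast b i).hom ψ) : φ = ψ := by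
  refine coind_ext fun r p => ?_
  by_cases hp : p ∈ Set.range fun q : shiftEmb.obj b ⟶ r => q ≫ incl r
  · obtain ⟨q, rfl⟩ := hp
    change coindEval U (q ≫ incl r) φ = coindEval U (q ≫ incl r) ψ
    rw [← incl_naturality, coindEval_comp, coindEval_comp, h]
  · obtain ⟨i, q, rfl⟩ := exists_eq_toLast_comp hp
    rw [coindEval_comp, coindEval_comp, h']

/-- An element of `R(U)_0` is determined by its value at the standard inclusion. -/
lemma coind_ext_zero [IsEmpty (Fin a.n)] {φ ψ : ((coind k G).obj U).obj a}
    (h : coindEval U (incl _) φ = coindEval U (incl _) ψ) : φ = ψ := by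
  refine coind_ext fun r p => ?_
  obtain ⟨q, rfl⟩ := mem_range_comp_incl.mpr (isEmptyElim : ∀ x, p.f x ≠ last r)
  change coindEval U (q ≫ incl r) φ = coindEval U (q ≫ incl r) ψ
  rw [← incl_naturality, coindEval_comp, coindEval_comp, h]

end Coinduction

end FIG

/-! ### Maps out of induced representations -/

namespace Representation

open scoped MonoidAlgebra

variable {k H K A P : Type*} [CommRing k] [Group H] [Group K] (φ : H →* K) [AddCommGroup A]
  [Module k A] (ρ : Representation k H A) [AddCommGroup P] [Module k P]

lemma IndV.mk_mul_apply (g : H) (h : K) (x : A) :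
    IndV.mk φ ρ (φ g * h) (ρ g x) = IndV.mk φ ρ h x := by
  simpa using Coinvariants.mk_self_apply (tprod ((leftRegular k K).comp φ) ρ) g
    (MonoidAlgebra.single h 1 ⊗ₜ[k] x)

/-- A linear map out of the induced representation, given by its values `f h x` on the classes
`⟦h ⊗ x⟧`. -/
noncomputable def IndV.lift (f : K → A →ₗ[k] P) (hf : ∀ g h x, f (φ g * h) (ρ g x) = f h x) :
    IndV φ ρ →ₗ[k] P :=
  Coinvariants.lift _ (TensorProduct.lift
    (Finsupp.linearCombination k f ∘ₗ (MonoidAlgebra.coeffLinearEquiv k).toLinearMap)) fun g => by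
      ext h x
      simp [hf]

lemma IndV.lift_mk (f : K → A →ₗ[k] P) (hf : ∀ g h x, f (φ g * h) (ρ g x) = f h x) (h : K)
    (x : A) : IndV.lift φ ρ f hf (IndV.mk φ ρ h x) = f h x := by
  simp [IndV.lift]

end Representation

namespace FIG

open Representation

variable {k : Type u} [CommRing k] {G : Type v} [Group G] {n : ℕ} {a b c r : FIG G}

/-! ### Basic filtered modules -/

section BasicFiltered

variable (W : Rep.{max u v} k (WrGroup G n))

lemma rightAct_single (s : WrGroup G n) (q : FIG.mk n ⟶ b) (c : k) :
    rightAct (k := k) n b s (Finsupp.single q c) = Finsupp.single (s.asHom ≫ q) c :=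
  Finsupp.mapDomain_single (f := (s.asHom ≫ ·))

/-- The pure tensor `q ⊗ w ∈ M(W)_m` for a morphism `q : [n] → [m]`, as a linear function of
`w ∈ W`. -/
noncomputable def pureTensor (q : FIG.mk n ⟶ b) : W →ₗ[k] (basicFiltered W).obj b :=
  Submodule.mkQ _ ∘ₗ TensorProduct.mk k _ _ (Finsupp.single q 1)

lemma pureTensor_comp (s : WrGroup G n) (q : FIG.mk n ⟶ b) (w : W) :
    pureTensor W (s.asHom ≫ q) w = pureTensor W q (W.ρ s w) := by
  refine Eq.trans ?_ (BalancedTensor.tmul_balanced (rightAct n b) W.ρ s (Finsupp.single q 1) w)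
  rw [rightAct_single]
  rfl

lemma map_pureTensor (q : FIG.mk n ⟶ b) (w : W) (p : b ⟶ c) :
    ((basicFiltered W).map p).hom (pureTensor W q w) = pureTensor W (q ≫ p) w :=
  congrArg (BalancedTensor.tmul (rightAct n c) W.ρ · w) (Finsupp.mapDomain_single (f := (· ≫ p)))

variable {W}

lemma basicFiltered_ext {P : Type*} [AddCommGroup P] [Module k P]
    {f g : (basicFiltered W).obj b →ₗ[k] P}
    (h : ∀ q w, f (pureTensor W q w) = g (pureTensor W q w)) : f = g := by
  refine BalancedTensor.hom_ext fun x w => ?_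
  let e : ((FIG.mk n ⟶ b) →₀ k) →ₗ[k] (basicFiltered W).obj b :=
    Submodule.mkQ _ ∘ₗ (TensorProduct.mk k ((FIG.mk n ⟶ b) →₀ k) W).flip w
  have he : f ∘ₗ e = g ∘ₗ e := Finsupp.lhom_ext' fun q => LinearMap.ext_ring (h q w)
  exact LinearMap.congr_fun he x

/-- A linear map out of `M(W)_m`, given by its values on pure tensors. -/
noncomputable def basicFilteredLift {P : Type*} [AddCommGroup P] [Module k P]
    (f : (FIG.mk n ⟶ b) → W →ₗ[k] P)
    (hf : ∀ (s : WrGroup G n) q w, f (s.asHom ≫ q) w = f q (W.ρ s w)) :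
    (basicFiltered W).obj b →ₗ[k] P :=
  BalancedTensor.lift (Finsupp.linearCombination k f) fun s x w => by
    let F : ((FIG.mk n ⟶ b) →₀ k) →ₗ[k] W →ₗ[k] P := Finsupp.linearCombination k f
    have h : F.flip w ∘ₗ Finsupp.lmapDomain k k (s.asHom ≫ ·) = F.flip (W.ρ s w) :=
      Finsupp.lhom_ext' fun q => LinearMap.ext_ring <| by simp [F, hf]
    exact LinearMap.congr_fun h x

lemma basicFilteredLift_pureTensor {P : Type*} [AddCommGroup P] [Module k P]
    (f : (FIG.mk n ⟶ b) → W →ₗ[k] P)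
    (hf : ∀ (s : WrGroup G n) q w, f (s.asHom ≫ q) w = f q (W.ρ s w)) (q : FIG.mk n ⟶ b) (w : W) :
    basicFilteredLift f hf (pureTensor W q w) = f q w := by
  refine (LinearMap.congr_fun (Finsupp.linearCombination_single k 1 q) w).trans ?_
  rw [one_smul]

variable (W)

open Classical in
/-- For an injection `j` of `Hom([n], [m])` into a set `B`, the function on `B` with values in
`Hom(W, M(W)_m)` which sends `j q` to `w ↦ q ⊗ w` and the elements outside the image of `j` to `0`.
The definition makes sense for every `j`, but is useful only if `j` is injective. -/
noncomputable def partialTensor {B : Type*} (j : (FIG.mk n ⟶ b) → B) (p : B) :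
    W →ₗ[k] (basicFiltered W).obj b :=
  if h : p ∈ Set.range j then pureTensor W h.choose else 0

variable {W} in
lemma partialTensor_apply {B : Type*} {j : (FIG.mk n ⟶ b) → B} (hj : Function.Injective j)
    (q : FIG.mk n ⟶ b) : partialTensor W j (j q) = pureTensor W q := by
  have h : j q ∈ Set.range j := ⟨q, rfl⟩
  rw [partialTensor, dif_pos h, hj h.choose_spec]

variable {W} in
lemma partialTensor_eq_zero {B : Type*} {j : (FIG.mk n ⟶ b) → B} {p : B} (h : p ∉ Set.range j) :
    partialTensor W j p = 0 := dif_neg h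

variable {W} in
/-- If the right action of `G_n` on morphisms extends to `B`, then `partialTensor W j` is balanced
over it. The set of elements outside the image of `j` is stable because `G_n` is a group. -/
lemma partialTensor_equivariant {B : Type*} {j : (FIG.mk n ⟶ b) → B} (hj : Function.Injective j)
    (act : WrGroup G n → B → B) (hact : ∀ s q, j (s.asHom ≫ q) = act s (j q))
    (hinv : ∀ s p, act s⁻¹ (act s p) = p) (s : WrGroup G n) (p : B) (w : W) :
    partialTensor W j (act s p) w = partialTensor W j p (W.ρ s w) := by
  by_cases hp : p ∈ Set.range j
  · obtain ⟨q, rfl⟩ := hp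
    rw [← hact, partialTensor_apply hj, partialTensor_apply hj, pureTensor_comp]
  · have hp' : act s p ∉ Set.range j := by
      rintro ⟨q, hq⟩
      exact hp ⟨s⁻¹.asHom ≫ q, by rw [hact, hq, hinv]⟩
    rw [partialTensor_eq_zero hp, partialTensor_eq_zero hp']
    rfl

variable {W} in
/-- Partial tensors are natural with respect to cartesian squares: an element of `B` which `e` sends
into the image of `j'` is already in the image of `j`. -/
lemma map_partialTensor {B C : Type*} {j : (FIG.mk n ⟶ b) → B} (hj : Function.Injective j)
    {j' : (FIG.mk n ⟶ c) → C} (hj' : Function.Injective j') {e : B → C} {h : b ⟶ c}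
    (comm : ∀ q, e (j q) = j' (q ≫ h)) (cart : ∀ p, e p ∈ Set.range j' → p ∈ Set.range j)
    (p : B) (w : W) :
    ((basicFiltered W).map h).hom (partialTensor W j p w) = partialTensor W j' (e p) w := by
  by_cases hp : p ∈ Set.range j
  · obtain ⟨q, rfl⟩ := hp
    rw [comm, partialTensor_apply hj, partialTensor_apply hj', map_pureTensor]
  · rw [partialTensor_eq_zero hp, partialTensor_eq_zero fun h => hp (cart p h)]
    exact map_zero _

end BasicFiltered
/-! ### The two morphisms into `M(W)` from shifts -/

section Shift

lemma asHom_inv_comp (s : WrGroup G n) (q : FIG.mk n ⟶ b) :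
    (s⁻¹).asHom ≫ s.asHom ≫ q = q := by
  rw [← Category.assoc]
  change (s * s⁻¹).asHom ≫ q = q
  rw [mul_inv_cancel]
  exact Category.id_comp q

variable (W : Rep.{max u v} k (WrGroup G n))

section ShiftLift

variable {W} {U : Mod k G} (f : ∀ r : FIG G, (FIG.mk n ⟶ shiftEmb.obj r) → W →ₗ[k] U.obj r)
  (hf : ∀ r (s : WrGroup G n) p w, f r (s.asHom ≫ p) w = f r p (W.ρ s w))

/-- A morphism `Σ M(W) ⟶ U`, given by its values on pure tensors. -/
noncomputable def basicFilteredShiftLift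
    (nat : ∀ (r s : FIG G) (h : r ⟶ s) p w,
      (U.map h).hom (f r p w) = f s (p ≫ shiftEmb.map h) w) :
    (shift k G).obj (basicFiltered W) ⟶ U where
  app r := ModuleCat.ofHom <| basicFilteredLift (b := shiftEmb.obj r) (f r) (hf r)
  naturality r s h := ModuleCat.hom_ext <| basicFiltered_ext (b := shiftEmb.obj r) fun p w => by
    refine (congrArg (basicFilteredLift (f s) (hf s))
      (map_pureTensor W p w (shiftEmb.map h))).trans ?_
    refine Eq.trans ?_
      (congrArg (U.map h).hom (basicFilteredLift_pureTensor (f r) (hf r) p w)).symm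
    rw [basicFilteredLift_pureTensor, nat]

lemma basicFilteredShiftLift_pureTensor
    (nat : ∀ (r s : FIG G) (h : r ⟶ s) p w,
      (U.map h).hom (f r p w) = f s (p ≫ shiftEmb.map h) w)
    (p : FIG.mk n ⟶ shiftEmb.obj r) (w : W) :
    ((basicFilteredShiftLift f hf nat).app r).hom (pureTensor W p w) = f r p w :=
  basicFilteredLift_pureTensor (f r) (hf r) p w

end ShiftLift

/-- The morphism `Σ M(W) ⟶ M(W)` which sends `p ⊗ w`, for `p : [n] → [m+1]`, to `q ⊗ w` if `p` is
a morphism `q : [n] → [m]` followed by the standard inclusion, and to `0` if the image of `p`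
contains the last element. -/
noncomputable def avoidLast : (shift k G).obj (basicFiltered W) ⟶ basicFiltered W :=
  basicFilteredShiftLift (fun r => partialTensor W (fun q : FIG.mk n ⟶ r => q ≫ incl r))
    (fun r => partialTensor_equivariant (comp_incl_injective _ _) (fun s p => s.asHom ≫ p)
      (fun _ _ => Category.assoc _ _ _) fun s p => asHom_inv_comp s p)
    fun r s h => map_partialTensor (comp_incl_injective _ _) (comp_incl_injective _ _)
      (e := (· ≫ shiftEmb.map h)) (fun q => by simp only [Category.assoc, incl_naturality])
      (fun p => mem_range_comp_incl_of_comp h)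

lemma avoidLast_pureTensor (p : FIG.mk n ⟶ shiftEmb.obj r) (w : W) :
    ((avoidLast W).app r).hom (pureTensor W p w) =
      partialTensor W (fun q : FIG.mk n ⟶ r => q ≫ incl r) p w :=
  basicFilteredShiftLift_pureTensor _ _ _ p w

/-- `avoidLast` is a retraction of the map `M(W) ⟶ Σ M(W)` given by the standard inclusions. -/
lemma avoidLast_map_incl (x : (basicFiltered W).obj r) :
    ((avoidLast W).app r).hom (((basicFiltered W).map (incl r)).hom x) = x := by
  suffices ((avoidLast W).app r).hom ∘ₗ ((basicFiltered W).map (incl r)).hom = LinearMap.id from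
    LinearMap.congr_fun this x
  refine basicFiltered_ext fun q w => ?_
  refine (congrArg ((avoidLast W).app r).hom (map_pureTensor W q w (incl r))).trans ?_
  rw [avoidLast_pureTensor]
  exact LinearMap.congr_fun (partialTensor_apply (comp_incl_injective _ _) q) w

/-- The map `W → Ind W`, `w ↦ 1 ⊗ w`. -/
noncomputable abbrev indUnit : W →ₗ[k] Rep.ind (WrGroup.incl G n) W :=
  IndV.mk (WrGroup.incl G n) W.ρ 1

variable {W} in
/-- As `q ⊗ (s ⊗ w) = (q ∘ s) ⊗ (1 ⊗ w)`, the module `M(Ind W)` is generated by the pure tensors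
`q ⊗ (1 ⊗ w)`. -/
lemma basicFiltered_ind_ext {P : Type*} [AddCommGroup P] [Module k P]
    {f g : (basicFiltered (Rep.ind (WrGroup.incl G n) W)).obj b →ₗ[k] P}
    (h : ∀ q w, f (pureTensor _ q (indUnit W w)) = g (pureTensor _ q (indUnit W w))) : f = g := by
  refine basicFiltered_ext fun q y => ?_
  suffices f ∘ₗ pureTensor _ q = g ∘ₗ pureTensor _ q from LinearMap.congr_fun this y
  refine IndV.hom_ext _ _ fun s => LinearMap.ext fun w => ?_
  have hs : IndV.mk (WrGroup.incl G n) W.ρ s w =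
      (Rep.ind (WrGroup.incl G n) W).ρ s⁻¹ (indUnit W w) := by
    refine Eq.trans ?_ (ind_mk _ _ _ _ _).symm
    rw [inv_inv, one_mul]
  change f (pureTensor _ q (IndV.mk _ _ s w)) = g (pureTensor _ q (IndV.mk _ _ s w))
  rw [hs, ← pureTensor_comp, h]

/-- The pure tensor `q ⊗ w` if `p : [n+1] → [m+1]` is the extension of `q : [n] → [m]`, and `0`
if `p` is not an extension. -/
noncomputable def extTensor (p : FIG.mk (n + 1) ⟶ shiftEmb.obj r) :
    W →ₗ[k] (basicFiltered W).obj r :=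
  partialTensor W (fun q : FIG.mk n ⟶ r => shiftEmb.map q) p

lemma extTensor_incl_comp (s : WrGroup G n) (p : FIG.mk (n + 1) ⟶ shiftEmb.obj r) (w : W) :
    extTensor W ((WrGroup.incl G n s).asHom ≫ p) w = extTensor W p (W.ρ s w) :=
  partialTensor_equivariant (shiftEmb_map_injective _ _)
    (fun s p => (WrGroup.incl G n s).asHom ≫ p) (fun s q => shiftEmb.map_comp s.asHom q)
    (fun s p => by
      rw [map_inv]
      exact asHom_inv_comp (WrGroup.incl G n s) p) s p w

lemma map_extTensor (p : FIG.mk (n + 1) ⟶ shiftEmb.obj r) (h : r ⟶ b) (w : W) :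
    ((basicFiltered W).map h).hom (extTensor W p w) = extTensor W (p ≫ shiftEmb.map h) w :=
  map_partialTensor (shiftEmb_map_injective _ _) (shiftEmb_map_injective _ _)
    (e := fun p : FIG.mk (n + 1) ⟶ shiftEmb.obj r => p ≫ shiftEmb.map h)
    (fun q => (shiftEmb.map_comp q h).symm) (fun _ => mem_range_shiftEmb_map_of_comp (a := .mk n) h)
    p w

lemma extTensor_shiftEmb_map (q : FIG.mk n ⟶ r) :
    extTensor W (shiftEmb.map q) = pureTensor W q :=
  partialTensor_apply (shiftEmb_map_injective _ _) q

variable {W} in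
lemma extTensor_eq_zero {p : FIG.mk (n + 1) ⟶ shiftEmb.obj r}
    (hp : p ∉ Set.range fun q : FIG.mk n ⟶ r => shiftEmb.map q) : extTensor W p = 0 :=
  partialTensor_eq_zero hp

/-- The map `Ind W → M(W)_m` which sends `s ⊗ w` to `extTensor W (p ∘ s) w`. In the coinvariants
model of `Ind W` the tensor `s ⊗ w` is represented by `s⁻¹`. -/
noncomputable def indExtTensor (p : FIG.mk (n + 1) ⟶ shiftEmb.obj r) :
    Rep.ind (WrGroup.incl G n) W →ₗ[k] (basicFiltered W).obj r :=
  IndV.lift (WrGroup.incl G n) W.ρ (fun s => extTensor W ((s⁻¹).asHom ≫ p)) fun g s w => by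
    have h : (WrGroup.incl G n g).asHom ≫ ((WrGroup.incl G n g * s)⁻¹).asHom = (s⁻¹).asHom := by
      change ((WrGroup.incl G n g * s)⁻¹ * WrGroup.incl G n g).asHom = _
      rw [mul_inv_rev, inv_mul_cancel_right]
    rw [← extTensor_incl_comp, ← h]
    exact congrArg (extTensor W · w) (Category.assoc _ _ _).symm

lemma indExtTensor_mk (p : FIG.mk (n + 1) ⟶ shiftEmb.obj r) (s : WrGroup G (n + 1)) (w : W) :
    indExtTensor W p (IndV.mk (WrGroup.incl G n) W.ρ s w) = extTensor W ((s⁻¹).asHom ≫ p) w :=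
  IndV.lift_mk _ _ _ _ s w

lemma indExtTensor_indUnit (p : FIG.mk (n + 1) ⟶ shiftEmb.obj r) (w : W) :
    indExtTensor W p (indUnit W w) = extTensor W p w := by
  rw [indExtTensor_mk, inv_one]
  exact congrArg (extTensor W · w) (Category.id_comp p)

lemma indExtTensor_comp (s : WrGroup G (n + 1)) (p : FIG.mk (n + 1) ⟶ shiftEmb.obj r)
    (y : Rep.ind (WrGroup.incl G n) W) :
    indExtTensor W (s.asHom ≫ p) y =
      indExtTensor W p ((Rep.ind (WrGroup.incl G n) W).ρ s y) := by
  suffices indExtTensor W (s.asHom ≫ p) =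
    indExtTensor W p ∘ₗ (Rep.ind (WrGroup.incl G n) W).ρ s from LinearMap.congr_fun this y
  refine IndV.hom_ext _ _ fun t => LinearMap.ext fun w => ?_
  refine (indExtTensor_mk W _ t w).trans ?_
  refine Eq.trans ?_ (congrArg (indExtTensor W p) (ind_mk _ _ s t w)).symm
  rw [indExtTensor_mk, mul_inv_rev, inv_inv]
  exact congrArg (extTensor W · w) (Category.assoc _ _ _).symm

lemma map_indExtTensor (p : FIG.mk (n + 1) ⟶ shiftEmb.obj r) (h : r ⟶ b)
    (y : Rep.ind (WrGroup.incl G n) W) :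
    ((basicFiltered W).map h).hom (indExtTensor W p y) =
      indExtTensor W (p ≫ shiftEmb.map h) y := by
  suffices ((basicFiltered W).map h).hom ∘ₗ indExtTensor W p =
    indExtTensor W (p ≫ shiftEmb.map h) from LinearMap.congr_fun this y
  refine IndV.hom_ext _ _ fun t => LinearMap.ext fun w => ?_
  refine (congrArg ((basicFiltered W).map h).hom (indExtTensor_mk W p t w)).trans ?_
  refine Eq.trans ?_ (indExtTensor_mk W _ t w).symm
  rw [map_extTensor, Category.assoc]

/-- The morphism `Σ M(Ind W) ⟶ M(W)` which sends `p ⊗ (1 ⊗ w)`, for `p : [n+1] → [m+1]`, to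
`q ⊗ w` if `p` is the extension of `q : [n] → [m]`, and to `0` if `p` is not an extension. -/
noncomputable def fixLast :
    (shift k G).obj (basicFiltered (Rep.ind (WrGroup.incl G n) W)) ⟶ basicFiltered W :=
  basicFilteredShiftLift (fun _ => indExtTensor W) (fun _ => indExtTensor_comp W)
    fun _ _ h p => map_indExtTensor W p h

lemma fixLast_pureTensor (p : FIG.mk (n + 1) ⟶ shiftEmb.obj r) (w : W) :
    ((fixLast W).app r).hom (pureTensor _ p (indUnit W w)) = extTensor W p w :=
  (basicFilteredShiftLift_pureTensor _ _ _ p _).trans (indExtTensor_indUnit W p w)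

/-- The map `M(Ind W)_m → M(W)_r`, `y ↦ fixLast (p_* y)`, for `p : [m] → [r+1]`. -/
noncomputable def fixLastAt (p : a ⟶ shiftEmb.obj r) :
    (basicFiltered (Rep.ind (WrGroup.incl G n) W)).obj a →ₗ[k] (basicFiltered W).obj r :=
  ((fixLast W).app r).hom ∘ₗ ((basicFiltered (Rep.ind (WrGroup.incl G n) W)).map p).hom

lemma fixLastAt_pureTensor (p : a ⟶ shiftEmb.obj r) (q : FIG.mk (n + 1) ⟶ a) (w : W) :
    fixLastAt W p (pureTensor _ q (indUnit W w)) = extTensor W (q ≫ p) w :=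
  (congrArg ((fixLast W).app r).hom (map_pureTensor _ q _ p)).trans (fixLast_pureTensor W _ w)

/-- The section `M(W)_m → (Σ M(Ind W))_m`, `q ⊗ w ↦ ι q ⊗ (1 ⊗ w)`, of `fixLast`, followed by the
map `p_*` for `p : [m+1] → [l]`. -/
noncomputable def extendAt (p : shiftEmb.obj r ⟶ a) :
    (basicFiltered W).obj r →ₗ[k] (basicFiltered (Rep.ind (WrGroup.incl G n) W)).obj a :=
  ((basicFiltered (Rep.ind (WrGroup.incl G n) W)).map p).hom ∘ₗ
    basicFilteredLift (fun q => pureTensor (Rep.ind (WrGroup.incl G n) W) (shiftEmb.map q) ∘ₗ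
      indUnit W) fun s q w => by
        have h : (Rep.ind (WrGroup.incl G n) W).ρ (WrGroup.incl G n s) (indUnit W w) =
            indUnit W (W.ρ s w) := by
          refine (ind_mk _ _ _ _ _).trans ?_
          rw [← IndV.mk_mul_apply _ _ s, one_mul, mul_inv_cancel]
        rw [shiftEmb.map_comp]
        refine (pureTensor_comp _ (WrGroup.incl G n s) (shiftEmb.map q) _).trans ?_
        rw [h]
        rfl

lemma extendAt_pureTensor (p : shiftEmb.obj r ⟶ a) (q : FIG.mk n ⟶ r) (w : W) :
    extendAt W p (pureTensor W q w) =
      pureTensor (Rep.ind (WrGroup.incl G n) W) (shiftEmb.map q ≫ p) (indUnit W w) :=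
  (congrArg ((basicFiltered (Rep.ind (WrGroup.incl G n) W)).map p).hom
    (basicFilteredLift_pureTensor _ _ q w)).trans (map_pureTensor _ (shiftEmb.map q) _ p)

end Shift
/-! ### The splitting of the coinduction -/

lemma isIso_biprod_desc {A B C : Mod k G} (f : A ⟶ C) (g : B ⟶ C)
    (inj : ∀ a x y, (f.app a).hom x + (g.app a).hom y = 0 → x = 0 ∧ y = 0)
    (surj : ∀ a z, ∃ x y, (f.app a).hom x + (g.app a).hom y = z) : IsIso (biprod.desc f g) := by
  let D : A ⊞ B ⟶ C := biprod.desc f g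
  let p : A ⊞ B ⟶ A := biprod.fst
  let q : A ⊞ B ⟶ B := biprod.snd
  let i : A ⟶ A ⊞ B := biprod.inl
  let j : B ⟶ A ⊞ B := biprod.inr
  have hD : D = p ≫ f + q ≫ g := biprod.desc_eq
  have hid : p ≫ i + q ≫ j = 𝟙 (A ⊞ B) := biprod.total
  have hi : i ≫ D = f := biprod.inl_desc f g
  have hj : j ≫ D = g := biprod.inr_desc f g
  have (a : FIG G) : IsIso (D.app a) := by
    refine (ConcreteCategory.isIso_iff_bijective _).mpr ⟨?_, fun z => ?_⟩
    · refine (injective_iff_map_eq_zero (D.app a).hom).mpr fun z hz => ?_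
      rw [hD] at hz
      obtain ⟨hx, hy⟩ := inj a ((p.app a).hom z) ((q.app a).hom z) hz
      have h : (i.app a).hom ((p.app a).hom z) + (j.app a).hom ((q.app a).hom z) = z :=
        congrArg (fun F : A ⊞ B ⟶ A ⊞ B => (F.app a).hom z) hid
      rw [← h, hx, hy, map_zero, map_zero, add_zero]
    · obtain ⟨x, y, rfl⟩ := surj a z
      refine ⟨(i.app a).hom x + (j.app a).hom y, ?_⟩
      refine (map_add (D.app a).hom _ _).trans (congrArg₂ (· + ·) ?_ ?_)
      · exact congrArg (fun F : A ⟶ C => (F.app a).hom x) hi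
      · exact congrArg (fun F : B ⟶ C => (F.app a).hom y) hj
  exact NatIso.isIso_of_isIso_app D

section Splitting

variable (W : Rep.{max u v} k (WrGroup G n))

/-- A morphism whose image avoids the last element is not an extension. -/
lemma fixLastAt_incl (y : (basicFiltered (Rep.ind (WrGroup.incl G n) W)).obj r) :
    fixLastAt W (incl r) y = 0 := by
  suffices fixLastAt W (incl r) = 0 from LinearMap.congr_fun this y
  refine basicFiltered_ind_ext fun q w => ?_
  rw [fixLastAt_pureTensor, extTensor_eq_zero]
  · rfl
  · intro h
    exact incl_f_ne_last _ (mem_range_shiftEmb_map (a := .mk n).mp h).1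

lemma fixLastAt_extendAt_self (i : Fin (shiftEmb.obj b).n × G) (x : (basicFiltered W).obj b) :
    fixLastAt W (toLast b i).hom (extendAt W (toLast b i).inv x) = x := by
  suffices fixLastAt W (toLast b i).hom ∘ₗ extendAt W (toLast b i).inv = LinearMap.id from
    LinearMap.congr_fun this x
  refine basicFiltered_ext fun q w => ?_
  rw [LinearMap.comp_apply, extendAt_pureTensor]
  refine (fixLastAt_pureTensor W _ _ w).trans ?_
  have h : (shiftEmb.map q ≫ (toLast b i).inv) ≫ (toLast b i).hom = shiftEmb.map q := by
    rw [Category.assoc, Iso.inv_hom_id, Category.comp_id]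
  exact (congrArg (extTensor W · w) h).trans
    (LinearMap.congr_fun (extTensor_shiftEmb_map W q) w)

lemma fixLastAt_extendAt_of_ne {i j : Fin (shiftEmb.obj b).n × G} (hij : j ≠ i)
    (x : (basicFiltered W).obj b) :
    fixLastAt W (toLast b j).hom (extendAt W (toLast b i).inv x) = 0 := by
  suffices fixLastAt W (toLast b j).hom ∘ₗ extendAt W (toLast b i).inv = 0 from
    LinearMap.congr_fun this x
  refine basicFiltered_ext fun q w => ?_
  rw [LinearMap.comp_apply, extendAt_pureTensor]
  refine (fixLastAt_pureTensor W _ _ w).trans ?_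
  exact LinearMap.congr_fun (extTensor_eq_zero fun h =>
    hij ((shiftEmb_map_comp_toLast_mem_range_iff q i j).mp h)) w

/-- Every element of `M(Ind W)_{m+1}` is reconstructed from its images under the maps
`fixLastAt W (toLast b i).hom`, because for each `q : [n+1] → [m+1]` exactly one of the composites
of `q` with some `toLast b i` is an extension. -/
lemma sum_extendAt_fixLastAt [Fintype G]
    (y : (basicFiltered (Rep.ind (WrGroup.incl G n) W)).obj (shiftEmb.obj b)) :
    ∑ i, extendAt W (toLast b i).inv (fixLastAt W (toLast b i).hom y) = y := by
  suffices ∑ i, extendAt W (toLast b i).inv ∘ₗ fixLastAt W (toLast b i).hom = LinearMap.id by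
    simpa using LinearMap.congr_fun this y
  refine basicFiltered_ind_ext fun q w => ?_
  have hmem (i) := comp_toLast_mem_range_iff (a := .mk n) q i
  -- The index for which `q ≫ (toLast b i).hom` is an extension.
  rw [LinearMap.sum_apply, Finset.sum_eq_single (q.f (last (.mk n)), (q.g (last (.mk n)))⁻¹)]
  · rw [LinearMap.comp_apply, fixLastAt_pureTensor]
    obtain ⟨p, hp⟩ := (hmem _).mpr rfl
    have hp' : shiftEmb.map p = q ≫ (toLast b (q.f (last (.mk n)),
      (q.g (last (.mk n)))⁻¹)).hom := hp
    have hq := (Iso.eq_comp_inv _).mpr hp'.symm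
    refine (congrArg (extendAt W _) (congrArg (extTensor W · w) hp'.symm)).trans ?_
    refine (congrArg (extendAt W _)
      (LinearMap.congr_fun (extTensor_shiftEmb_map W p) w)).trans ?_
    rw [extendAt_pureTensor]
    exact congrArg (pureTensor _ · (indUnit W w)) hq.symm
  · intro i _ hi
    rw [LinearMap.comp_apply, fixLastAt_pureTensor]
    have h := LinearMap.congr_fun (extTensor_eq_zero (W := W) fun h => hi ((hmem i).mp h)) w
    exact (congrArg (extendAt W _) h).trans (map_zero _)
  · exact fun h => absurd (Finset.mem_univ _) h

lemma isEmpty_or_exists_eq_shiftEmb_obj (a : FIG G) :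
    IsEmpty (Fin a.n) ∨ ∃ b : FIG G, a = shiftEmb.obj b := by
  obtain ⟨_ | m⟩ := a
  · exact .inl Fin.isEmpty
  · exact .inr ⟨⟨m⟩, rfl⟩

/-- `M(Ind W)` vanishes at `[0]`. -/
lemma basicFiltered_eq_zero [IsEmpty (Fin a.n)]
    (y : (basicFiltered (Rep.ind (WrGroup.incl G n) W)).obj a) : y = 0 := by
  suffices (LinearMap.id : (basicFiltered (Rep.ind (WrGroup.incl G n) W)).obj a →ₗ[k] _) = 0 from
    LinearMap.congr_fun this y
  exact basicFiltered_ext fun q => isEmptyElim (q.f (Fin.last n))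

lemma coindEval_incl_coindLift_avoidLast (x : (basicFiltered W).obj a) :
    coindEval _ (incl a) (((coindLift (avoidLast W)).app a).hom x) = x :=
  (coindEval_coindLift _ x _).trans (avoidLast_map_incl W x)

lemma coindEval_coindLift_fixLast (p : a ⟶ shiftEmb.obj r)
    (y : (basicFiltered (Rep.ind (WrGroup.incl G n) W)).obj a) :
    coindEval _ p (((coindLift (fixLast W)).app a).hom y) = fixLastAt W p y :=
  coindEval_coindLift _ y p

/-- Evaluation at the standard inclusion splits `M(W) → R(M(W))`, and vanishes on the image
of `M(Ind W)`. -/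
lemma coindEval_incl_add (x : (basicFiltered W).obj a)
    (y : (basicFiltered (Rep.ind (WrGroup.incl G n) W)).obj a) :
    coindEval _ (incl a) (((coindLift (avoidLast W)).app a).hom x +
      ((coindLift (fixLast W)).app a).hom y) = x := by
  refine (map_add (coindEval _ (incl a)) _ _).trans ?_
  rw [coindEval_incl_coindLift_avoidLast, coindEval_coindLift_fixLast, fixLastAt_incl, add_zero]

/-- The kernel of the evaluation at the standard inclusion is the image of `M(Ind W)`. -/
lemma exists_coindLift_fixLast_eq [Finite G] (φ : ((coind k G).obj (basicFiltered W)).obj a)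
    (hφ : coindEval _ (incl a) φ = 0) : ∃ y, ((coindLift (fixLast W)).app a).hom y = φ := by
  have := Fintype.ofFinite G
  obtain h | ⟨b, rfl⟩ := isEmpty_or_exists_eq_shiftEmb_obj a
  · refine ⟨0, coind_ext_zero ?_⟩
    rw [hφ, coindEval_coindLift_fixLast, map_zero]
  · -- Assemble the preimage from its coordinates at the `toLast b i`.
    refine ⟨∑ i, extendAt W (toLast b i).inv (coindEval _ (toLast b i).hom φ),
      coind_ext_toLast ?_ fun j => ?_⟩
    · rw [hφ, coindEval_coindLift_fixLast, fixLastAt_incl]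
    · rw [coindEval_coindLift_fixLast, map_sum, Finset.sum_eq_single j]
      · exact fixLastAt_extendAt_self W j _
      · exact fun i _ hij => fixLastAt_extendAt_of_ne W hij.symm _
      · exact fun h => absurd (Finset.mem_univ _) h

lemma coindLift_fixLast_injective [Finite G] (a : FIG G) :
    Function.Injective ((coindLift (fixLast W)).app a).hom := by
  have := Fintype.ofFinite G
  refine (injective_iff_map_eq_zero _).mpr fun y hy => ?_
  obtain h | ⟨b, rfl⟩ := isEmpty_or_exists_eq_shiftEmb_obj a
  · exact basicFiltered_eq_zero W y
  · rw [← sum_extendAt_fixLastAt W y]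
    refine Finset.sum_eq_zero fun i _ => ?_
    rw [← coindEval_coindLift_fixLast, hy, map_zero, map_zero]

end Splitting
end FIG

theorem mainTheorem8 {k : Type u} [CommRing k] [IsNoetherianRing k]
    {G : Type v} [Group G] [Finite G] (n : ℕ)
    (W : Rep.{max u v} k (WrGroup G n))
    [Module.Finite (MonoidAlgebra k (WrGroup G n)) W.ρ.asModule] :
    Nonempty ((FIG.coind k G).obj (FIG.basicFiltered W) ≅
      FIG.basicFiltered W ⊞ FIG.basicFiltered (Rep.ind (WrGroup.incl G n) W)) := by
  have : IsIso (biprod.desc (FIG.coindLift (FIG.avoidLast W)) (FIG.coindLift (FIG.fixLast W))) := by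
    refine FIG.isIso_biprod_desc _ _ (fun a x y hxy => ?_) fun a φ => ?_
    · have hx : x = 0 := by
        rw [← FIG.coindEval_incl_add W x y, hxy, map_zero]
      rw [hx, map_zero, zero_add] at hxy
      exact ⟨hx, FIG.coindLift_fixLast_injective W a (hxy.trans (map_zero _).symm)⟩
    · -- Subtracting the section applied to the value at `incl` leaves an element of the kernel.
      set x := FIG.coindEval _ (FIG.incl a) φ with hx
      obtain ⟨y, hy⟩ := FIG.exists_coindLift_fixLast_eq W
        (φ - ((FIG.coindLift (FIG.avoidLast W)).app a).hom x)
        (by rw [map_sub, FIG.coindEval_incl_coindLift_avoidLast, hx, sub_self])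
      exact ⟨x, y, by rw [hy, add_sub_cancel]⟩
  exact ⟨(asIso (biprod.desc (FIG.coindLift (FIG.avoidLast W))
    (FIG.coindLift (FIG.fixLast W)))).symm⟩
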